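/- **Setting.** Let $f:(0,\infty)\to\mathbb R$ be twice continuously differentiable with $f''>0$ and $f(1)=0$, and put $\tilde f(r)=r f(1/r)$. Let $p_r$ on $\mathbb R^d$ (data) and $p_z$ on $\mathbb R^k$ (latent) be strictly positive, continuously differentiable probability densities with respect to Lebesgue measure. Let $\Theta\subseteq\mathbb R^l$ and $\Phi\subseteq\mathbb R^n$ be open parameter sets, and let $G_\theta(z,\epsilon)\in\mathbb R^d$ ($\theta\in\Theta$) and $E_\phi(x,\epsilon)\in\mathbb R^k$ ($\phi\in\Phi$) be stochastic transformations, measurable in $(z,\epsilon)$ and in $(x,\epsilon)$ respectively, where the noise $\epsilon\sim p_\epsilon$ is independent of $z\sim p_z$ and of $x\sim p_r$ (the noises of $G$ and $E$ may have different laws). Suppose that, for almost every $z$, $G_\theta(z,\epsilon)$ has a Lebesgue density $p_g(x|z)=p_{g,\theta}(x|z)$ and that, for almost every $x$, $E_\phi(x,\epsilon)$ has a Lebesgue density $p_e(z|x)=p_{e,\phi}(z|x)$, both strictly positive everywhere and continuously differentiable jointly in $(\theta,x,z)$, respectively in $(\phi,z,x)$. Write $$p_e(x,z)=p_r(x)\,p_e(z|x),\qquad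 p_g(x,z)=p_z(z)\,p_g(x|z),\qquad r=\frac{p_e(x,z)}{p_g(x,z)},\qquad \mathcal D=\log r,$$ $$L(\theta,\phi)=D_f(p_e,p_g)=\int \ell_{\theta,\phi}(x,z)\,dx\,dz,\qquad \ell_{\theta,\phi}=p_g\, f(p_e/p_g).$$ Fix $\theta\in\Theta$, $\phi\in\Phi$, and assume the following regularity. 1. $\ell_{\theta,\phi}$ is integrable; for almost every $(x,z)$ the map $\theta'\mapsto \ell_{\theta',\phi}(x,z)$ is Lipschitz on a fixed neighbourhood of $\theta$ with a Lipschitz constant that is integrable in $(x,z)$; and likewise for $\phi'\mapsto\ell_{\theta,\phi'}(x,z)$ near $\phi$. 2. For almost every $(z,\epsilon)$ the map $\theta'\mapsto G_{\theta'}(z,\epsilon)$ is differentiable at $\theta$ and is Lipschitz on a fixed neighbourhood of $\theta$ with a Lipschitz constant of finite expectation; and likewise for $\phi'\mapsto E_{\phi'}(x,\epsilon)$ at $\phi$, for almost every $(x,\epsilon)$. 3. (No flux at infinity.) $\mathbb E_{z,\epsilon}\big[|\tilde f'(1/r)|\,\|\nabla_\theta G_\theta(z,\epsilon)\|\big]<\infty$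 with $r$ taken at $(G_\theta(z,\epsilon),z)$, and $\mathbb E_{x,\epsilon}\big[|f'(r)|\,\|\nabla_\phi E_\phi(x,\epsilon)\|\big]<\infty$ with $r$ taken at $(x,E_\phi(x,\epsilon))$. 4. The two expectations on the right-hand sides below exist, i.e. their integrands are integrable. **Theorem.** The partial gradients of $L$ at $(\theta,\phi)$ exist, and $$\nabla_\theta L(\theta,\phi)=-\mathbb E_{z\sim p_z,\,\epsilon\sim p_\epsilon}\big[s_\theta(G_\theta(z,\epsilon),z)\,\nabla_x\mathcal D(G_\theta(z,\epsilon),z)^\top\,\nabla_\theta G_\theta(z,\epsilon)\big],$$ $$\nabla_\phi L(\theta,\phi)=\mathbb E_{x\sim p_r,\,\epsilon\sim p_\epsilon}\big[s_\phi(x,E_\phi(x,\epsilon))\,\nabla_z\mathcal D(x,E_\phi(x,\epsilon))^\top\,\nabla_\phi E_\phi(x,\epsilon)\big],$$ where $s_\theta(x,z)=\tilde f''(1/r(x,z))/r(x,z)$ and $s_\phi(x,z)=f''(r(x,z))\,r(x,z)$. Here $\nabla_x\mathcal D$ and $\nabla_z\mathcal D$ are gradients in $x$ and in $z$ with $(\theta,\phi)$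 held fixed, and $\nabla_\theta G_\theta$, $\nabla_\phi E_\phi$ are Jacobian matrices. -/

import Mathlib

open MeasureTheory Set Filter Topology

noncomputable section

/-- The measure on a Euclidean space with Lebesgue density `p`. -/
def densityMeasure {E : Type*} [MeasureSpace E] (p : E → ℝ) : Measure E :=
  volume.withDensity fun x => ENNReal.ofReal (p x)

/-- `p · c` is the Lebesgue density of the conditional law, given `c`, of `T c ε` with `ε ∼ ν`
(for almost every `c`). -/
def IsCondDensity {C N Y : Type*} [MeasureSpace C] [MeasurableSpace N] [MeasureSpace Y]
    (T : C → N → Y) (ν : Measure N) (p : Y → C → ℝ) : Prop :=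
  ∀ᵐ c : C, ν.map (T c) = densityMeasure fun y => p y c

/-- `f̃(r) = r f(1/r)`. -/
def fTilde (f : ℝ → ℝ) (r : ℝ) : ℝ := r * f (1 / r)

/-- The density ratio `r = p / q`. -/
def ratio {Y : Type*} (p q : Y → ℝ) (y : Y) : ℝ := p y / q y

/-- The log density ratio `𝒟 = log (p / q)`. -/
def logRatio {Y : Type*} (p q : Y → ℝ) (y : Y) : ℝ := Real.log (p y / q y)

/-- The integrand `q f(p / q)` of the `f`-divergence of the densities `p` and `q`. -/
def fDivIntegrand {Y : Type*} (f : ℝ → ℝ) (p q : Y → ℝ) (y : Y) : ℝ := q y * f (ratio p q y)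

/-- The `f`-divergence `D_f(p, q) = 𝔼_q [f(p / q)]`. -/
def fDiv {Y : Type*} [MeasureSpace Y] (f : ℝ → ℝ) (p q : Y → ℝ) : ℝ :=
  ∫ y, fDivIntegrand f p q y

/-- The generator joint density `p_g(x, z) = p_z(z) p_g(x | z)`. -/
def genJoint {P X Z : Type*} (pz : Z → ℝ) (pg : P → X → Z → ℝ) (θ : P) (y : X × Z) : ℝ :=
  pz y.2 * pg θ y.1 y.2

/-- The encoder joint density `p_e(x, z) = p_r(x) p_e(z | x)`. -/
def encJoint {Q X Z : Type*} (pr : X → ℝ) (pe : Q → Z → X → ℝ) (φ : Q) (y : X × Z) : ℝ :=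
  pr y.1 * pe φ y.2 y.1

/-- The objective `L(θ, φ) = D_f(p_e, p_g)`. -/
def objective {P Q X Z : Type*} [MeasureSpace X] [MeasureSpace Z] (f : ℝ → ℝ)
    (pr : X → ℝ) (pz : Z → ℝ) (pg : P → X → Z → ℝ) (pe : Q → Z → X → ℝ) (θ : P) (φ : Q) : ℝ :=
  fDiv f (encJoint pr pe φ) (genJoint pz pg θ)

/-- The generator scaling factor `s_θ = f̃''(1 / r) / r`. -/
def scaleGen {Y : Type*} (f : ℝ → ℝ) (p q : Y → ℝ) (y : Y) : ℝ :=
  deriv (deriv (fTilde f)) (1 / ratio p q y) / ratio p q y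

/-- The encoder scaling factor `s_φ = f''(r) r`. -/
def scaleEnc {Y : Type*} (f : ℝ → ℝ) (p q : Y → ℝ) (y : Y) : ℝ :=
  deriv (deriv f) (ratio p q y) * ratio p q y

section Pathwise

variable {P Q X Z N M : Type*}
  [NormedAddCommGroup P] [InnerProductSpace ℝ P] [CompleteSpace P]
  [NormedAddCommGroup Q] [InnerProductSpace ℝ Q] [CompleteSpace Q]
  [NormedAddCommGroup X] [InnerProductSpace ℝ X] [CompleteSpace X]
  [NormedAddCommGroup Z] [InnerProductSpace ℝ Z] [CompleteSpace Z]

/-- The vector `s_θ(G_θ(z, ε), z) ∇ₓ𝒟(G_θ(z, ε), z)ᵀ ∇_θ G_θ(z, ε)` at `w = (z, ε)`; the row vector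
`vᵀ J` is represented by the vector `Jᵀ v`. -/
def genTerm (f : ℝ → ℝ) (p q : X × Z → ℝ) (G : P → Z → N → X) (θ : P) (w : Z × N) : P :=
  scaleGen f p q (G θ w.1 w.2, w.1) •
    ContinuousLinearMap.adjoint (fderiv ℝ (fun θ' => G θ' w.1 w.2) θ)
      (gradient (fun x => logRatio p q (x, w.1)) (G θ w.1 w.2))

/-- The vector `s_φ(x, E_φ(x, ε)) ∇_z𝒟(x, E_φ(x, ε))ᵀ ∇_φ E_φ(x, ε)` at `w = (x, ε)`. -/
def encTerm (f : ℝ → ℝ) (p q : X × Z → ℝ) (E : Q → X → M → Z) (φ : Q) (w : X × M) : Q :=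
  scaleEnc f p q (w.1, E φ w.1 w.2) •
    ContinuousLinearMap.adjoint (fderiv ℝ (fun φ' => E φ' w.1 w.2) φ)
      (gradient (fun z => logRatio p q (w.1, z)) (E φ w.1 w.2))

end Pathwise

/-- Near `p₀`, the function `p ↦ u p ω` is Lipschitz for almost every `ω`, with a `μ`-integrable
Lipschitz constant. -/
def DominatedLipschitzAt {P Ω F : Type*} [NormedAddCommGroup P] [NormedAddCommGroup F]
    [MeasurableSpace Ω] (μ : Measure Ω) (u : P → Ω → F) (p₀ : P) : Prop :=
  ∃ U ∈ 𝓝 p₀, ∃ B : Ω → ℝ, Integrable B μ ∧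
    ∀ᵐ ω ∂μ, ∀ p ∈ U, ∀ p' ∈ U, ‖u p ω - u p' ω‖ ≤ B ω * ‖p - p'‖

end

/-! Both gradients are instances of `hasGradientAt_divergence`, which differentiates `∫ u g(q_θ/u)`
when `q_θ` is the density of the law of a random point `S_θ` and `u` is fixed. The encoder case has
`S = (x, E_φ)`, `u = p_g`, `g = f`. The generator case has `S = (G_θ, z)`, `u = p_e`, `g = f̃`,
because `q f(p/q) = p f̃(q/p)`.

Differentiating the integrand gives `∫ h ∂_θ q_θ` with `h = g'(q_θ/u)`, where `h` is then frozen at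
the given `θ`. For frozen `h` this is the derivative of `𝔼 h(S_θ)`, which can also be taken along
the path as `𝔼 [∇h(S_θ) ∂_θ S_θ]`. The two agree for compactly supported test functions
(`integral_mul_fderiv_density_of_hasCompactSupport`), and cutoffs with the integrable flux extend
this to `h` (`integral_mul_fderiv_density`). Finally `∇h = g''(ρ) ρ ∇ log ρ` with `ρ = q_θ/u`. For
the generator `ρ = 1/r`, so `log ρ = -𝒟`, whence the minus sign. -/

/-! ### Parametric densities and their derivatives in the parameter -/

section PartialDerivative

variable {P E : Type*} [NormedAddCommGroup P] [NormedSpace ℝ P]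
  [NormedAddCommGroup E] [NormedSpace ℝ E] {Θ : Set P} {q : P → E → ℝ}

theorem hasFDerivAt_param (hΘ : IsOpen Θ)
    (hq : ContDiffOn ℝ 1 (fun x : P × E => q x.1 x.2) (Θ ×ˢ univ)) {θ : P} (hθ : θ ∈ Θ) (y : E) :
    HasFDerivAt (fun θ' => q θ' y)
      ((fderiv ℝ (fun x : P × E => q x.1 x.2) (θ, y)).comp (ContinuousLinearMap.inl ℝ P E)) θ := by
  have h1 : HasFDerivAt (fun x : P × E => q x.1 x.2)
      (fderiv ℝ (fun x : P × E => q x.1 x.2) (θ, y)) (θ, y) :=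
    ((hq.contDiffAt ((hΘ.prod isOpen_univ).mem_nhds ⟨hθ, mem_univ _⟩)).differentiableAt
      one_ne_zero).hasFDerivAt
  exact HasFDerivAt.comp (f := fun θ' => (θ', y)) θ h1 (hasFDerivAt_prodMk_left θ y)

theorem continuous_fderiv_param (hΘ : IsOpen Θ)
    (hq : ContDiffOn ℝ 1 (fun x : P × E => q x.1 x.2) (Θ ×ˢ univ)) {θ : P} (hθ : θ ∈ Θ) :
    Continuous fun y => fderiv ℝ (fun θ' => q θ' y) θ := by
  have h1 := hq.continuousOn_fderiv_of_isOpen (hΘ.prod isOpen_univ) le_rfl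
  have h2 : Continuous fun y : E => fderiv ℝ (fun x : P × E => q x.1 x.2) (θ, y) :=
    h1.comp_continuous (by fun_prop) fun y => ⟨hθ, mem_univ _⟩
  simp_rw [fun y => (hasFDerivAt_param hΘ hq hθ y).fderiv]
  fun_prop

theorem contDiff_section (hq : ContDiffOn ℝ 1 (fun x : P × E => q x.1 x.2) (Θ ×ˢ univ))
    {θ : P} (hθ : θ ∈ Θ) : ContDiff ℝ 1 (q θ) := by
  have h2 : ContDiff ℝ 1 fun y : E => ((θ, y) : P × E) := by fun_prop
  exact contDiffOn_univ.1 (hq.comp h2.contDiffOn fun y _ => ⟨hθ, mem_univ _⟩)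

theorem hasDerivAt_line (θ v : P) (t : ℝ) : HasDerivAt (fun t : ℝ => θ + t • v) v t := by
  simpa using ((hasDerivAt_id t).smul_const v).const_add θ

theorem tendsto_line (θ v : P) : Tendsto (fun t : ℝ => θ + t • v) (𝓝 0) (𝓝 θ) := by
  simpa using (hasDerivAt_line θ v 0).continuousAt.tendsto

/-- Differentiation under the integral of a compactly supported function times a parametric one. -/
theorem hasDerivAt_integral_mul_param [FiniteDimensional ℝ P] [MeasureSpace E] [BorelSpace E]
    [SecondCountableTopology E]
    [IsFiniteMeasureOnCompacts (volume : Measure E)] (hΘ : IsOpen Θ)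
    (hq : ContDiffOn ℝ 1 (fun x : P × E => q x.1 x.2) (Θ ×ˢ univ)) {θ : P} (hθ : θ ∈ Θ)
    {ψ : E → ℝ} (hψ : Continuous ψ) (hψc : HasCompactSupport ψ) (v : P) :
    HasDerivAt (fun t : ℝ => ∫ y, ψ y * q (θ + t • v) y)
      (∫ y, ψ y * fderiv ℝ (fun θ' => q θ' y) θ v) 0 := by
  set D := fderiv ℝ (fun x : P × E => q x.1 x.2) with hD
  obtain ⟨δ, hδ, hball⟩ := Metric.nhds_basis_closedBall.mem_iff.1 (hΘ.mem_nhds hθ)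
  -- Compactness in both variables bounds the joint derivative by `C` for parameters near `θ` and
  -- `y` in the support of `ψ`; off that support the integrand vanishes.
  obtain ⟨C, hC⟩ := ((isCompact_closedBall θ δ).prod hψc.isCompact).exists_bound_of_continuousOn
    ((hq.continuousOn_fderiv_of_isOpen (hΘ.prod isOpen_univ) le_rfl).mono
      (prod_mono hball (subset_univ _)))
  have hs : {t : ℝ | θ + t • v ∈ Metric.closedBall θ δ} ∈ 𝓝 (0 : ℝ) :=
    tendsto_line θ v (Metric.closedBall_mem_nhds θ hδ)
  have hcont : ∀ θ' ∈ Θ, Continuous fun y => ψ y * q θ' y := fun θ' h =>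
    hψ.mul (contDiff_section hq h).continuous
  have key := hasDerivAt_integral_of_dominated_loc_of_deriv_le (μ := (volume : Measure E))
    (F := fun (t : ℝ) y => ψ y * q (θ + t • v) y) (x₀ := 0)
    (F' := fun t y => ψ y * D (θ + t • v, y) (v, 0))
    (bound := fun y => ‖ψ y‖ * (C * ‖((v, 0) : P × E)‖)) hs
    (by
      filter_upwards [hs] with t ht
      exact (hcont _ (hball ht)).aestronglyMeasurable)
    (by
      simp only [zero_smul, add_zero]
      exact (hcont θ hθ).integrable_of_hasCompactSupport hψc.mul_right)
    (by
      simp only [zero_smul, add_zero]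
      have h2 : Continuous fun y : E => D (θ, y) :=
        (hq.continuousOn_fderiv_of_isOpen (hΘ.prod isOpen_univ) le_rfl).comp_continuous
          (by fun_prop) fun y => ⟨hθ, mem_univ _⟩
      exact (hψ.mul (h2.clm_apply continuous_const)).aestronglyMeasurable)
    (by
      refine ae_of_all _ fun y t ht => ?_
      rw [norm_mul]
      by_cases hy : y ∈ tsupport ψ
      · gcongr
        exact (D _).le_of_opNorm_le (hC (θ + t • v, y) ⟨ht, hy⟩) _
      · simp [image_eq_zero_of_notMem_tsupport hy])
    ((hψ.norm.mul continuous_const).integrable_of_hasCompactSupport hψc.norm.mul_right)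
    (by
      refine ae_of_all _ fun y t ht => ?_
      have h1 := (hasFDerivAt_param hΘ hq (hball ht) y).comp_hasDerivAt t (hasDerivAt_line θ v t)
      simpa using h1.const_mul (ψ y))
  have heq : ∫ y, ψ y * fderiv ℝ (fun θ' => q θ' y) θ v =
      ∫ y, ψ y * D (θ + (0 : ℝ) • v, y) (v, 0) := by
    refine integral_congr_ae (ae_of_all _ fun y => ?_)
    simp [(hasFDerivAt_param hΘ hq hθ y).fderiv, hD]
  rw [heq]
  exact key.2

end PartialDerivative

/-! ### Derivative of an expectation: through the density and along the path -/

section Pushforward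

variable {P E Ω : Type*} [NormedAddCommGroup P] [NormedSpace ℝ P]
  [NormedAddCommGroup E] [NormedSpace ℝ E] [MeasurableSpace Ω] {μ : Measure Ω}
  {Θ : Set P} {q : P → E → ℝ} {S : P → Ω → E} {θ : P}

theorem integral_densityMeasure {E : Type*} [TopologicalSpace E] [MeasureSpace E] [BorelSpace E]
    {p : E → ℝ} (hp : Continuous p)
    (hp0 : ∀ y, 0 ≤ p y) (g : E → ℝ) :
    ∫ y, g y ∂densityMeasure p = ∫ y, g y * p y := by
  rw [densityMeasure, integral_withDensity_eq_integral_toReal_smul (by fun_prop)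
    (ae_of_all _ fun _ => ENNReal.ofReal_lt_top)]
  refine integral_congr_ae (ae_of_all _ fun y => ?_)
  simp [ENNReal.toReal_ofReal (hp0 y), mul_comm]

/-- The directional derivative is the almost everywhere limit of a sequence of difference quotients,
each of them measurable. -/
theorem aestronglyMeasurable_fderiv_param_apply (hΘ : IsOpen Θ) (hθ : θ ∈ Θ)
    (hS : ∀ θ' ∈ Θ, AEStronglyMeasurable (S θ') μ)
    (hd : ∀ᵐ w ∂μ, DifferentiableAt ℝ (fun θ' => S θ' w) θ) (v : P) :
    AEStronglyMeasurable (fun w => fderiv ℝ (fun θ' => S θ' w) θ v) μ := by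
  have ht : Tendsto (fun n : ℕ => 1 / ((n : ℝ) + 1)) atTop (𝓝 0) :=
    tendsto_one_div_add_atTop_nhds_zero_nat
  -- Measurability is known only for parameters in `Θ`, so the sequence of step sizes is shifted by
  -- `N` to keep every term inside.
  obtain ⟨N, hN⟩ := eventually_atTop.1
    (((tendsto_line θ v).comp ht).eventually (hΘ.mem_nhds hθ))
  have ht' : Tendsto (fun n : ℕ => 1 / (((n + N : ℕ) : ℝ) + 1)) atTop (𝓝[≠] 0) := by
    refine tendsto_nhdsWithin_iff.2 ⟨ht.comp (tendsto_add_atTop_nat N), ?_⟩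
    exact Eventually.of_forall fun n => by
      simp only [mem_compl_iff, mem_singleton_iff]; positivity
  refine aestronglyMeasurable_of_tendsto_ae atTop
    (f := fun (n : ℕ) w => (1 / (((n + N : ℕ) : ℝ) + 1))⁻¹ •
      (S (θ + (1 / (((n + N : ℕ) : ℝ) + 1)) • v) w - S θ w))
    (fun n => ((hS _ (hN _ (Nat.le_add_left N n))).sub (hS θ hθ)).const_smul _) ?_
  filter_upwards [hd] with w hw
  have h0 : HasFDerivAt (fun θ' => S θ' w) (fderiv ℝ (fun θ' => S θ' w) θ) (θ + (0 : ℝ) • v) := by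
    simpa using hw.hasFDerivAt
  have h1 := (h0.comp_hasDerivAt (0 : ℝ) (hasDerivAt_line θ v 0)).tendsto_slope_zero.comp ht'
  simpa [Function.comp_def] using h1

/-- Differentiation under the integral of a test function along a random path. -/
theorem hasDerivAt_integral_comp_path [MeasurableSpace E] [BorelSpace E]
    [SecondCountableTopology E] [IsFiniteMeasure μ] (hΘ : IsOpen Θ) (hθ : θ ∈ Θ)
    (hS : ∀ θ' ∈ Θ, Measurable (S θ'))
    (hd : ∀ᵐ w ∂μ, DifferentiableAt ℝ (fun θ' => S θ' w) θ)
    (hl : DominatedLipschitzAt μ S θ) {ψ : E → ℝ} (hψ : ContDiff ℝ 1 ψ)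
    (hψc : HasCompactSupport ψ) (v : P) :
    HasDerivAt (fun t : ℝ => ∫ w, ψ (S (θ + t • v) w) ∂μ)
      (∫ w, fderiv ℝ ψ (S θ w) (fderiv ℝ (fun θ' => S θ' w) θ v) ∂μ) 0 := by
  obtain ⟨U, hU, B, hB, hUB⟩ := hl
  -- The test function is `K`-Lipschitz, so `K * (B w * ‖v‖)` dominates the increments in `t`; its
  -- bound `C` gives integrability for the finite measure `μ`.
  obtain ⟨K, hK⟩ := hψ.lipschitzWith_of_hasCompactSupport hψc one_ne_zero
  obtain ⟨C, hC⟩ := hψc.exists_bound_of_continuous hψ.continuous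
  have hs : {t : ℝ | θ + t • v ∈ U ∩ Θ} ∈ 𝓝 (0 : ℝ) :=
    tendsto_line θ v (inter_mem hU (hΘ.mem_nhds hθ))
  have hmeas : ∀ θ' ∈ Θ, AEStronglyMeasurable (fun w => ψ (S θ' w)) μ := fun θ' h =>
    (hψ.continuous.measurable.comp (hS θ' h)).aestronglyMeasurable
  have hF : ∀ᵐ w ∂μ, HasDerivAt (fun t : ℝ => ψ (S (θ + t • v) w))
      (fderiv ℝ ψ (S θ w) (fderiv ℝ (fun θ' => S θ' w) θ v)) 0 := by
    filter_upwards [hd] with w hw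
    have h0 : HasFDerivAt (fun θ' => ψ (S θ' w))
        ((fderiv ℝ ψ (S θ w)).comp (fderiv ℝ (fun θ' => S θ' w) θ)) (θ + (0 : ℝ) • v) := by
      rw [zero_smul, add_zero]
      exact ((hψ.differentiable one_ne_zero) (S θ w)).hasFDerivAt.comp θ hw.hasFDerivAt
    exact HasFDerivAt.comp_hasDerivAt (f := fun t : ℝ => θ + t • v) (0 : ℝ) h0
      (hasDerivAt_line θ v 0)
  refine (hasDerivAt_integral_of_dominated_loc_of_lip (μ := μ)
    (F := fun (t : ℝ) w => ψ (S (θ + t • v) w)) (x₀ := 0)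
    (bound := fun w => K * (B w * ‖v‖)) hs ?_ ?_ ?_ ?_ ((hB.mul_const _).const_mul _) hF).2
  · filter_upwards [hs] with t ht
    exact hmeas _ ht.2
  · simp only [zero_smul, add_zero]
    exact Integrable.of_bound (hmeas θ hθ) C (ae_of_all _ fun w => hC _)
  · have h1 := aestronglyMeasurable_fderiv_param_apply hΘ hθ
      (fun θ' h => (hS θ' h).aestronglyMeasurable) hd v
    have h2 : AEStronglyMeasurable (fun w => fderiv ℝ ψ (S θ w)) μ :=
      (hψ.continuous_fderiv one_ne_zero).comp_aestronglyMeasurable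
        (hS θ hθ).aestronglyMeasurable
    exact (ContinuousLinearMap.apply ℝ ℝ : E →L[ℝ] _).flip.aestronglyMeasurable_comp₂ h2 h1
  · filter_upwards [hUB] with w hw
    refine LipschitzOnWith.of_dist_le_mul fun t ht t' ht' => ?_
    rw [Real.coe_nnabs]
    calc dist (ψ (S (θ + t • v) w)) (ψ (S (θ + t' • v) w))
        ≤ K * dist (S (θ + t • v) w) (S (θ + t' • v) w) := hK.dist_le_mul _ _
      _ ≤ K * (B w * ‖(θ + t • v) - (θ + t' • v)‖) := by
          rw [dist_eq_norm]
          gcongr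
          exact hw _ ht.1 _ ht'.1
      _ = K * (B w * ‖v‖) * dist t t' := by
          rw [add_sub_add_left_eq_sub, ← sub_smul, norm_smul, dist_eq_norm]; ring
      _ ≤ |K * (B w * ‖v‖)| * dist t t' := by
          gcongr
          exact le_abs_self _

variable [FiniteDimensional ℝ P] [FiniteDimensional ℝ E] [MeasureSpace E] [BorelSpace E]
  [IsFiniteMeasureOnCompacts (volume : Measure E)] [IsFiniteMeasure μ]

/-- The two expressions of the derivative of `𝔼 ψ(S_θ)` agree for a test function `ψ`. -/
theorem integral_mul_fderiv_density_of_hasCompactSupport (hΘ : IsOpen Θ) (hθ : θ ∈ Θ)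
    (hq : ContDiffOn ℝ 1 (fun x : P × E => q x.1 x.2) (Θ ×ˢ univ))
    (hq0 : ∀ θ' ∈ Θ, ∀ y, 0 < q θ' y)
    (hS : ∀ θ' ∈ Θ, Measurable (S θ')) (hlaw : ∀ θ' ∈ Θ, μ.map (S θ') = densityMeasure (q θ'))
    (hd : ∀ᵐ w ∂μ, DifferentiableAt ℝ (fun θ' => S θ' w) θ)
    (hl : DominatedLipschitzAt μ S θ) {ψ : E → ℝ} (hψ : ContDiff ℝ 1 ψ)
    (hψc : HasCompactSupport ψ) (v : P) :
    ∫ y, ψ y * fderiv ℝ (fun θ' => q θ' y) θ v =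
      ∫ w, fderiv ℝ ψ (S θ w) (fderiv ℝ (fun θ' => S θ' w) θ v) ∂μ := by
  have : ProperSpace E := FiniteDimensional.proper ℝ E
  -- For small `t` both integrals equal `𝔼 ψ(S_{θ+tv})`, so their derivatives at `0` coincide.
  refine (hasDerivAt_integral_mul_param hΘ hq hθ hψ.continuous hψc v).unique
    ((hasDerivAt_integral_comp_path hΘ hθ hS hd hl hψ hψc v).congr_of_eventuallyEq ?_)
  filter_upwards [tendsto_line θ v (hΘ.mem_nhds hθ)] with t ht
  rw [← integral_densityMeasure (contDiff_section hq ht).continuous fun y => (hq0 _ ht y).le,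
    ← hlaw _ ht,
    integral_map (hS _ ht).aemeasurable hψ.continuous.aestronglyMeasurable]

/-- A sequence of smooth cutoffs exhausting the space, with gradients tending to zero. -/
theorem exists_cutoff (E : Type*) [NormedAddCommGroup E] [NormedSpace ℝ E]
    [FiniteDimensional ℝ E] :
    ∃ (χ : ℕ → E → ℝ) (K : ℝ), (∀ n, ContDiff ℝ 1 (χ n)) ∧ (∀ n, HasCompactSupport (χ n)) ∧
      (∀ n y, |χ n y| ≤ 1) ∧ (∀ n y, ‖fderiv ℝ (χ n) y‖ ≤ K / (n + 1)) ∧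
      ∀ y, Tendsto (fun n => χ n y) atTop (𝓝 1) := by
  -- One bump, equal to `1` on the unit ball, is dilated by `n + 1`; this divides its gradient by `n
  -- + 1`.
  let b : ContDiffBump (0 : E) := ⟨1, 2, one_pos, one_lt_two⟩
  have hb : ContDiff ℝ 1 b := b.contDiff
  obtain ⟨K, hK⟩ := (b.hasCompactSupport.fderiv ℝ).exists_bound_of_continuous
    (hb.continuous_fderiv one_ne_zero)
  have hc : ∀ n : ℕ, (1 / ((n : ℝ) + 1)) ≠ 0 := fun n => by positivity
  refine ⟨fun n y => b ((1 / ((n : ℝ) + 1)) • y), K, fun n => by fun_prop, fun n =>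
    b.hasCompactSupport.comp_smul (hc n), fun n y => ?_, fun n y => ?_, fun y => ?_⟩
  · rw [abs_of_nonneg b.nonneg]
    exact b.le_one
  · rw [fderiv_comp_smul, norm_smul, Real.norm_of_nonneg (by positivity), one_div, mul_comm,
      div_eq_mul_inv]
    gcongr
    exact hK _
  · have h1 : Tendsto (fun n : ℕ => (1 / ((n : ℝ) + 1)) • y) atTop (𝓝 0) := by
      simpa using (tendsto_one_div_add_atTop_nhds_zero_nat (𝕜 := ℝ)).smul_const y
    refine tendsto_const_nhds.congr' ?_
    filter_upwards [h1 (Metric.closedBall_mem_nhds (0 : E) one_pos)] with n hn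
    exact (b.one_of_mem_closedBall hn).symm

/-- The two expressions of the derivative of `𝔼 h(S_θ)` agree when `h` has integrable flux. -/
theorem integral_mul_fderiv_density (hΘ : IsOpen Θ) (hθ : θ ∈ Θ)
    (hq : ContDiffOn ℝ 1 (fun x : P × E => q x.1 x.2) (Θ ×ˢ univ))
    (hq0 : ∀ θ' ∈ Θ, ∀ y, 0 < q θ' y)
    (hS : ∀ θ' ∈ Θ, Measurable (S θ')) (hlaw : ∀ θ' ∈ Θ, μ.map (S θ') = densityMeasure (q θ'))
    (hd : ∀ᵐ w ∂μ, DifferentiableAt ℝ (fun θ' => S θ' w) θ)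
    (hl : DominatedLipschitzAt μ S θ) {h : E → ℝ} (hh : ContDiff ℝ 1 h) (v : P)
    (hi : Integrable fun y => h y * fderiv ℝ (fun θ' => q θ' y) θ v)
    (hflux : Integrable (fun w => h (S θ w) * ‖fderiv ℝ (fun θ' => S θ' w) θ‖) μ)
    (hi' : Integrable (fun w => fderiv ℝ h (S θ w) (fderiv ℝ (fun θ' => S θ' w) θ v)) μ) :
    ∫ y, h y * fderiv ℝ (fun θ' => q θ' y) θ v =
      ∫ w, fderiv ℝ h (S θ w) (fderiv ℝ (fun θ' => S θ' w) θ v) ∂μ := by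
  have : ProperSpace E := FiniteDimensional.proper ℝ E
  obtain ⟨χ, K, hχ, hχc, hχ1, hχK, hχt⟩ := exists_cutoff E
  have hK0 : 0 ≤ K := by simpa using (norm_nonneg _).trans (hχK 0 0)
  have hfd : ∀ n y, fderiv ℝ (fun y => χ n y * h y) y =
      χ n y • fderiv ℝ h y + h y • fderiv ℝ (χ n) y :=
    fun n y => fderiv_fun_mul ((hχ n).differentiable one_ne_zero y)
      (hh.differentiable one_ne_zero y)
  have heq : ∀ n, ∫ y, (χ n y * h y) * fderiv ℝ (fun θ' => q θ' y) θ v =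
      ∫ w, fderiv ℝ (fun y => χ n y * h y) (S θ w) (fderiv ℝ (fun θ' => S θ' w) θ v) ∂μ := fun n =>
    integral_mul_fderiv_density_of_hasCompactSupport hΘ hθ hq hq0 hS hlaw hd hl
      ((hχ n).mul hh) (hχc n).mul_right v
  have hlim1 : Tendsto (fun n => ∫ y, (χ n y * h y) * fderiv ℝ (fun θ' => q θ' y) θ v) atTop
      (𝓝 (∫ y, h y * fderiv ℝ (fun θ' => q θ' y) θ v)) := by
    refine tendsto_integral_of_dominated_convergence _ (fun n => ?_) hi.norm (fun n => ?_) ?_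
    · simp_rw [mul_assoc]
      exact (hχ n).continuous.aestronglyMeasurable.mul hi.aestronglyMeasurable
    · refine ae_of_all _ fun y => ?_
      rw [mul_assoc, norm_mul]
      exact mul_le_of_le_one_left (norm_nonneg _) (hχ1 n y)
    · refine ae_of_all _ fun y => ?_
      simpa [mul_assoc] using (hχt y).mul_const (h y * fderiv ℝ (fun θ' => q θ' y) θ v)
  -- The error from differentiating the cutoff is at most `K / (n + 1)` times the flux. This is
  -- where the flux hypothesis enters: it dominates the error, which tends to zero.
  have hterm : ∀ n w, ‖h (S θ w) * fderiv ℝ (χ n) (S θ w) (fderiv ℝ (fun θ' => S θ' w) θ v)‖ ≤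
      K / (n + 1) * (‖h (S θ w) * ‖fderiv ℝ (fun θ' => S θ' w) θ‖‖ * ‖v‖) := fun n w => by
    have h1 := (fderiv ℝ (χ n) (S θ w)).le_of_opNorm_le (hχK n _)
      (fderiv ℝ (fun θ' => S θ' w) θ v)
    have h2 := (fderiv ℝ (fun θ' => S θ' w) θ).le_opNorm v
    rw [norm_mul, norm_mul, norm_norm]
    calc _ ≤ ‖h (S θ w)‖ * (K / (n + 1) * (‖fderiv ℝ (fun θ' => S θ' w) θ‖ * ‖v‖)) := by
          gcongr
          exact h1.trans (by gcongr)
      _ = _ := by ring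
  have hlim2 : Tendsto (fun n => ∫ w, fderiv ℝ (fun y => χ n y * h y) (S θ w)
      (fderiv ℝ (fun θ' => S θ' w) θ v) ∂μ) atTop
      (𝓝 (∫ w, fderiv ℝ h (S θ w) (fderiv ℝ (fun θ' => S θ' w) θ v) ∂μ)) := by
    refine tendsto_integral_of_dominated_convergence
      (fun w => ‖fderiv ℝ h (S θ w) (fderiv ℝ (fun θ' => S θ' w) θ v)‖ +
        K * (‖h (S θ w) * ‖fderiv ℝ (fun θ' => S θ' w) θ‖‖ * ‖v‖)) (fun n => ?_)
      (hi'.norm.add ((hflux.norm.mul_const _).const_mul K)) (fun n => ?_) ?_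
    · have h1 := aestronglyMeasurable_fderiv_param_apply hΘ hθ
        (fun θ' h => (hS θ' h).aestronglyMeasurable) hd v
      have h2 : AEStronglyMeasurable (fun w => fderiv ℝ (fun y => χ n y * h y) (S θ w)) μ :=
        (((hχ n).mul hh).continuous_fderiv one_ne_zero).comp_aestronglyMeasurable
          (hS θ hθ).aestronglyMeasurable
      exact (ContinuousLinearMap.apply ℝ ℝ : E →L[ℝ] _).flip.aestronglyMeasurable_comp₂ h2 h1
    · refine ae_of_all _ fun w => ?_
      rw [hfd]
      refine (norm_add_le _ _).trans (add_le_add ?_ ((hterm n w).trans ?_))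
      · change ‖χ n (S θ w) * _‖ ≤ _
        rw [norm_mul]
        exact mul_le_of_le_one_left (norm_nonneg _) (hχ1 n _)
      · gcongr
        exact div_le_self hK0 (by simp)
    · refine ae_of_all _ fun w => ?_
      simp_rw [hfd]
      have h1 := (hχt (S θ w)).mul_const
        (fderiv ℝ h (S θ w) (fderiv ℝ (fun θ' => S θ' w) θ v))
      have h2 : Tendsto (fun n : ℕ => K / ((n : ℝ) + 1) *
          (‖h (S θ w) * ‖fderiv ℝ (fun θ' => S θ' w) θ‖‖ * ‖v‖)) atTop (𝓝 0) := by
        have := ((tendsto_one_div_add_atTop_nhds_zero_nat (𝕜 := ℝ)).const_mul K).mul_const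
          (‖h (S θ w) * ‖fderiv ℝ (fun θ' => S θ' w) θ‖‖ * ‖v‖)
        simpa [div_eq_mul_inv] using this
      have h3 := squeeze_zero_norm (fun n => hterm n w) h2
      simpa using h1.add h3
  refine tendsto_nhds_unique hlim1 ?_
  simp_rw [heq]
  exact hlim2

end Pushforward

/-! ### Gradient of a divergence in its moving density -/

section Divergence

variable {P E Ω : Type*} [NormedAddCommGroup P] [InnerProductSpace ℝ P] [FiniteDimensional ℝ P]
  [NormedAddCommGroup E] [NormedSpace ℝ E] [MeasurableSpace Ω] {μ : Measure Ω}
  {Θ : Set P} {q : P → E → ℝ} {S : P → Ω → E} {θ : P} {g : ℝ → ℝ}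

theorem hasDerivAt_of_contDiffOn_Ioi (hg : ContDiffOn ℝ 2 g (Ioi 0)) {r : ℝ} (hr : 0 < r) :
    HasDerivAt g (deriv g r) r :=
  ((hg.contDiffAt (Ioi_mem_nhds hr)).differentiableAt two_ne_zero).hasDerivAt

theorem contDiffOn_deriv_Ioi (hg : ContDiffOn ℝ 2 g (Ioi 0)) : ContDiffOn ℝ 1 (deriv g) (Ioi 0) :=
  hg.deriv_of_isOpen isOpen_Ioi (by norm_num [one_add_one_eq_two])

theorem hasDerivAt_deriv_of_contDiffOn_Ioi (hg : ContDiffOn ℝ 2 g (Ioi 0)) {r : ℝ} (hr : 0 < r) :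
    HasDerivAt (deriv g) (deriv (deriv g) r) r :=
  (((contDiffOn_deriv_Ioi hg).contDiffAt (Ioi_mem_nhds hr)).differentiableAt one_ne_zero).hasDerivAt

/-- The gradient of `∫ u g(q_θ / u)` when `q_θ` is the density of the law of `S_θ`, expressed
through the pathwise derivative of `S_θ`. -/
theorem hasGradientAt_divergence [FiniteDimensional ℝ E] [MeasureSpace E] [BorelSpace E]
    [IsFiniteMeasureOnCompacts (volume : Measure E)] [IsFiniteMeasure μ]
    (hΘ : IsOpen Θ) (hθ : θ ∈ Θ)
    (hq : ContDiffOn ℝ 1 (fun x : P × E => q x.1 x.2) (Θ ×ˢ univ))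
    (hq0 : ∀ θ' ∈ Θ, ∀ y, 0 < q θ' y)
    (hS : ∀ θ' ∈ Θ, Measurable (S θ')) (hlaw : ∀ θ' ∈ Θ, μ.map (S θ') = densityMeasure (q θ'))
    (hd : ∀ᵐ w ∂μ, DifferentiableAt ℝ (fun θ' => S θ' w) θ)
    (hl : DominatedLipschitzAt μ S θ)
    (hg : ContDiffOn ℝ 2 g (Ioi 0)) {u : E → ℝ} (hu : ContDiff ℝ 1 u) (hu0 : ∀ y, 0 < u y)
    (hi : Integrable fun y => u y * g (q θ y / u y))
    (hil : DominatedLipschitzAt volume (fun θ' y => u y * g (q θ' y / u y)) θ)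
    (hflux : Integrable (fun w => deriv g (q θ (S θ w) / u (S θ w)) *
      ‖fderiv ℝ (fun θ' => S θ' w) θ‖) μ)
    -- The pathwise term is specified through its pairings with directions `v`: `E` will be a
    -- product with the sup norm, where no gradient is available.
    {V : Ω → P} (hV : Integrable V μ)
    (hVS : ∀ᵐ w ∂μ, ∀ v, inner ℝ v (V w) =
      fderiv ℝ (fun y => deriv g (q θ y / u y)) (S θ w) (fderiv ℝ (fun θ' => S θ' w) θ v)) :
    HasGradientAt (fun θ' => ∫ y, u y * g (q θ' y / u y)) (∫ w, V w ∂μ) θ := by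
  have : ProperSpace E := FiniteDimensional.proper ℝ E
  set h : E → ℝ := fun y => deriv g (q θ y / u y)
  have hρ0 : ∀ θ' ∈ Θ, ∀ y, 0 < q θ' y / u y := fun θ' hθ' y => div_pos (hq0 θ' hθ' y) (hu0 y)
  have hρ : ∀ θ' ∈ Θ, ContDiff ℝ 1 fun y => q θ' y / u y := fun θ' hθ' =>
    (contDiff_section hq hθ').div hu fun y => (hu0 y).ne'
  have hh : ContDiff ℝ 1 h :=
    contDiffOn_univ.1 ((contDiffOn_deriv_Ioi hg).comp (hρ θ hθ).contDiffOn fun y _ => hρ0 θ hθ y)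
  have hDq := continuous_fderiv_param hΘ hq hθ
  obtain ⟨U, hU, B, hB, hUB⟩ := hil
  have key := hasFDerivAt_integral_of_dominated_loc_of_lip (μ := (volume : Measure E))
    (F := fun θ' y => u y * g (q θ' y / u y)) (x₀ := θ) (bound := B)
    (F' := fun y => h y • fderiv ℝ (fun θ' => q θ' y) θ) hU
    (by
      filter_upwards [hΘ.mem_nhds hθ] with θ' hθ'
      exact (hu.continuous.mul (hg.continuousOn.comp_continuous (hρ θ' hθ').continuous
        (hρ0 θ' hθ'))).aestronglyMeasurable)
    hi (hh.continuous.smul hDq).aestronglyMeasurable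
    (by
      filter_upwards [hUB] with y hy
      refine LipschitzOnWith.of_dist_le_mul fun a ha b hb => ?_
      rw [Real.coe_nnabs, dist_eq_norm, dist_eq_norm]
      exact (hy a ha b hb).trans (by gcongr; exact le_abs_self _))
    hB
    (by
      refine ae_of_all _ fun y => ?_
      have h1 : HasFDerivAt (fun θ' => q θ' y) (fderiv ℝ (fun θ' => q θ' y) θ) θ :=
        (hasFDerivAt_param hΘ hq hθ y).differentiableAt.hasFDerivAt
      have h2 := ((hasDerivAt_of_contDiffOn_Ioi hg (hρ0 θ hθ y)).comp_hasFDerivAt θ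
        (h1.mul_const (u y)⁻¹)).const_mul (u y)
      refine h2.congr_fderiv ?_
      -- The weight `u y` cancels the factor `(u y)⁻¹` produced by the chain rule.
      rw [smul_smul, smul_smul]
      congr 1
      rw [mul_comm, inv_mul_cancel_left₀ (hu0 y).ne'])
  rw [hasGradientAt_iff_hasFDerivAt]
  refine key.2.congr_fderiv (ContinuousLinearMap.ext fun v => ?_)
  have hVv : (fun w => inner ℝ v (V w)) =ᵐ[μ] fun w =>
      fderiv ℝ h (S θ w) (fderiv ℝ (fun θ' => S θ' w) θ v) := by
    filter_upwards [hVS] with w hw using hw v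
  have hi' := (hV.const_inner (𝕜 := ℝ) v).congr hVv
  rw [ContinuousLinearMap.integral_apply key.1, InnerProductSpace.toDual_apply_apply,
    real_inner_comm, ← integral_inner hV, integral_congr_ae hVv]
  exact integral_mul_fderiv_density hΘ hθ hq hq0 hS hlaw hd hl hh v
    (key.1.apply_continuousLinearMap v) hflux hi'

/-- The chain rule `g''(ρ) ρ ∇ log ρ = ∇ g'(ρ)` along a map `i`. -/
theorem deriv_deriv_mul_fderiv_log {X : Type*} [NormedAddCommGroup X] [NormedSpace ℝ X]
    (hg : ContDiffOn ℝ 2 g (Ioi 0)) {ρ : E → ℝ} {i : X → E} {i' : X →L[ℝ] E} {x : X}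
    (hi : HasFDerivAt i i' x) (hρ : DifferentiableAt ℝ ρ (i x)) (hρ0 : 0 < ρ (i x)) (a : X) :
    deriv (deriv g) (ρ (i x)) * ρ (i x) * fderiv ℝ (fun x => Real.log (ρ (i x))) x a =
      fderiv ℝ (fun y => deriv g (ρ y)) (i x) (i' a) := by
  have h1 : HasFDerivAt (fun x => Real.log (ρ (i x)))
      ((ρ (i x))⁻¹ • (fderiv ℝ ρ (i x)).comp i') x :=
    (hρ.hasFDerivAt.comp x hi).log hρ0.ne'
  have h2 : HasFDerivAt (fun y => deriv g (ρ y))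
      (deriv (deriv g) (ρ (i x)) • fderiv ℝ ρ (i x)) (i x) :=
    (hasDerivAt_deriv_of_contDiffOn_Ioi hg hρ0).comp_hasFDerivAt (i x) hρ.hasFDerivAt
  rw [h1.fderiv, h2.fderiv]
  change _ * _ * (_ * fderiv ℝ ρ (i x) (i' a)) = _ * fderiv ℝ ρ (i x) (i' a)
  field_simp

end Divergence

theorem contDiffOn_fTilde {f : ℝ → ℝ} (hf : ContDiffOn ℝ 2 f (Ioi 0)) :
    ContDiffOn ℝ 2 (fTilde f) (Ioi 0) :=
  contDiffOn_id.mul (hf.comp (contDiffOn_const.div contDiffOn_id fun _ hr => (ne_of_gt hr))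
    fun _ hr => mem_Ioi.2 (one_div_pos.2 hr))

/-- Puts the moving generator density in the numerator, so that the generator case takes the form of
the encoder case. -/
theorem mul_fTilde_div {f : ℝ → ℝ} {p : ℝ} (q : ℝ) (hp : p ≠ 0) :
    p * fTilde f (q / p) = q * f (p / q) := by
  rw [fTilde, one_div_div, ← mul_assoc, mul_div_cancel₀ _ hp]

/-! ### Joint laws from conditional densities -/

section Law

variable {C N Y : Type*} [MeasureSpace C] [MeasureSpace Y] [MeasurableSpace N]
  {ν : Measure N} [SFinite ν]
  {T : C → N → Y} {p : C → ℝ} {ρ : Y → C → ℝ}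

/-- Tonelli reduces the claim to each fixed `c`, where the conditional law can be substituted; the
exceptional null set of `c` is harmless. Testing against arbitrary `F` then identifies both joint
laws. -/
theorem lintegral_densityMeasure_prod (hp : Measurable p)
    (hp0 : ∀ c, 0 ≤ p c) (hT : Measurable fun w : C × N => T w.1 w.2)
    (hρ : Measurable fun y : Y × C => ρ y.1 y.2)
    (h : IsCondDensity T ν ρ) {F : C → Y → ENNReal} (hF : Measurable fun x : C × Y => F x.1 x.2) :
    ∫⁻ w, F w.1 (T w.1 w.2) ∂(densityMeasure p).prod ν =
      ∫⁻ c, ∫⁻ y, ENNReal.ofReal (p c * ρ y c) * F c y := by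
  have hm : Measurable fun w : C × N => F w.1 (T w.1 w.2) := hF.comp (measurable_fst.prodMk hT)
  rw [lintegral_prod _ hm.aemeasurable, densityMeasure,
    lintegral_withDensity_eq_lintegral_mul _ (by fun_prop) hm.lintegral_prod_right']
  refine lintegral_congr_ae ?_
  filter_upwards [h] with c hc
  have hFc : Measurable (F c) := hF.comp measurable_prodMk_left
  have hρc : Measurable fun y => ρ y c := hρ.comp measurable_prodMk_right
  have h1 : ∫⁻ e, F c (T c e) ∂ν = ∫⁻ y, ENNReal.ofReal (ρ y c) * F c y := by
    rw [← lintegral_map hFc (show Measurable (T c) from hT.comp measurable_prodMk_left), hc,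
      densityMeasure,
      lintegral_withDensity_eq_lintegral_mul _ (by fun_prop) hFc]
    rfl
  simp_rw [ENNReal.ofReal_mul (hp0 c), mul_assoc]
  rw [lintegral_const_mul _ (by fun_prop), ← h1]
  rfl

theorem map_encoder_eq_densityMeasure [SFinite (volume : Measure Y)] (hp : Measurable p)
    (hp0 : ∀ c, 0 ≤ p c) (hT : Measurable fun w : C × N => T w.1 w.2)
    (hρ : Measurable fun y : Y × C => ρ y.1 y.2) (h : IsCondDensity T ν ρ) :
    ((densityMeasure p).prod ν).map (fun w => (w.1, T w.1 w.2)) =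
      densityMeasure fun y : C × Y => p y.1 * ρ y.2 y.1 := by
  have hρ' : Measurable fun y : C × Y => ρ y.2 y.1 := hρ.comp measurable_swap
  refine Measure.ext_of_lintegral _ fun F hF => ?_
  rw [lintegral_map hF (by fun_prop)]
  refine (lintegral_densityMeasure_prod hp hp0 hT hρ h (F := fun c y => F (c, y))
    (by fun_prop)).trans ?_
  rw [densityMeasure, lintegral_withDensity_eq_lintegral_mul _ (by fun_prop) hF,
    Measure.volume_eq_prod, lintegral_prod _ (by fun_prop)]
  rfl

theorem map_generator_eq_densityMeasure [SFinite (volume : Measure C)]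
    [SFinite (volume : Measure Y)] (hp : Measurable p) (hp0 : ∀ c, 0 ≤ p c)
    (hT : Measurable fun w : C × N => T w.1 w.2)
    (hρ : Measurable fun y : Y × C => ρ y.1 y.2) (h : IsCondDensity T ν ρ) :
    ((densityMeasure p).prod ν).map (fun w => (T w.1 w.2, w.1)) =
      densityMeasure fun y : Y × C => p y.2 * ρ y.1 y.2 := by
  refine Measure.ext_of_lintegral _ fun F hF => ?_
  rw [lintegral_map hF (by fun_prop)]
  refine (lintegral_densityMeasure_prod hp hp0 hT hρ h (F := fun c y => F (y, c))
    (by fun_prop)).trans ?_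
  -- The conditioning variable is now the second coordinate, so Tonelli is used in the opposite
  -- order.
  rw [densityMeasure, lintegral_withDensity_eq_lintegral_mul _ (by fun_prop) hF,
    Measure.volume_eq_prod, lintegral_prod_symm _ (by fun_prop)]
  rfl

end Law

/-! ### Regularity of the joint densities and of the random pairs -/

section Joint

variable {P X Z : Type*} [NormedAddCommGroup P] [NormedSpace ℝ P]
  [NormedAddCommGroup X] [NormedSpace ℝ X] [NormedAddCommGroup Z] [NormedSpace ℝ Z] {Θ : Set P}

theorem contDiffOn_genJoint {pz : Z → ℝ} (hpz : ContDiff ℝ 1 pz) {pg : P → X → Z → ℝ}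
    (hpg : ContDiffOn ℝ 1 (fun y : P × X × Z => pg y.1 y.2.1 y.2.2) (Θ ×ˢ univ)) :
    ContDiffOn ℝ 1 (fun x : P × X × Z => genJoint pz pg x.1 x.2) (Θ ×ˢ univ) := by
  have h : ContDiff ℝ 1 fun x : P × X × Z => pz x.2.2 := by fun_prop
  exact h.contDiffOn.mul hpg

theorem contDiffOn_encJoint {pr : X → ℝ} (hpr : ContDiff ℝ 1 pr) {pe : P → Z → X → ℝ}
    (hpe : ContDiffOn ℝ 1 (fun y : P × Z × X => pe y.1 y.2.1 y.2.2) (Θ ×ˢ univ)) :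
    ContDiffOn ℝ 1 (fun x : P × X × Z => encJoint pr pe x.1 x.2) (Θ ×ˢ univ) := by
  have h : ContDiff ℝ 1 fun x : P × X × Z => pr x.2.1 := by fun_prop
  have hs : ContDiff ℝ 1 fun x : P × X × Z => (x.1, x.2.2, x.2.1) := by fun_prop
  exact h.contDiffOn.mul (hpe.comp hs.contDiffOn fun x hx => ⟨hx.1, mem_univ _⟩)

end Joint

/-- Adjoining a parameter-independent component keeps dominated increments. -/
theorem DominatedLipschitzAt.congr_norm {P Ω F F' : Type*} [NormedAddCommGroup P]
    [NormedAddCommGroup F] [NormedAddCommGroup F'] [MeasurableSpace Ω] {μ : Measure Ω}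
    {u : P → Ω → F} {u' : P → Ω → F'} {p₀ : P} (h : DominatedLipschitzAt μ u p₀)
    (huu' : ∀ p p' ω, ‖u' p ω - u' p' ω‖ = ‖u p ω - u p' ω‖) : DominatedLipschitzAt μ u' p₀ := by
  simpa only [DominatedLipschitzAt, huu'] using h

theorem measurable_section_of_contDiffOn {P A B : Type*} [NormedAddCommGroup P] [NormedSpace ℝ P]
    [NormedAddCommGroup A] [NormedSpace ℝ A] [NormedAddCommGroup B] [NormedSpace ℝ B]
    [MeasurableSpace A] [BorelSpace A] [MeasurableSpace B] [BorelSpace B]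
    [SecondCountableTopologyEither A B] {Θ : Set P} {ρ : P → A → B → ℝ}
    (hρ : ContDiffOn ℝ 1 (fun y : P × A × B => ρ y.1 y.2.1 y.2.2) (Θ ×ˢ univ)) {θ : P}
    (hθ : θ ∈ Θ) : Measurable fun y : A × B => ρ θ y.1 y.2 :=
  (contDiff_section (q := fun θ (y : A × B) => ρ θ y.1 y.2) hρ hθ).continuous.measurable

/-! ### The two gradient formulas -/

theorem theorem1 {d k l n : ℕ} {N M : Type*} [MeasurableSpace N] [MeasurableSpace M]
    -- the noise distributions of generator and encoder
    (νG : Measure N) [IsProbabilityMeasure νG] (νE : Measure M) [IsProbabilityMeasure νE]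
    -- the function defining the divergence
    (f : ℝ → ℝ) (hf : ContDiffOn ℝ 2 f (Ioi 0)) (hf1 : f 1 = 0)
    (hf2 : ∀ r : ℝ, 0 < r → 0 < deriv (deriv f) r)
    -- the data density and the latent prior density
    (pr : EuclideanSpace ℝ (Fin d) → ℝ) (hpr : ContDiff ℝ 1 pr) (hpr0 : ∀ x, 0 < pr x)
    (hpr1 : IsProbabilityMeasure (densityMeasure pr))
    (pz : EuclideanSpace ℝ (Fin k) → ℝ) (hpz : ContDiff ℝ 1 pz) (hpz0 : ∀ z, 0 < pz z)
    (hpz1 : IsProbabilityMeasure (densityMeasure pz))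
    -- the generator and its conditional density `pg θ x z = p_g(x | z)`
    (Θ : Set (EuclideanSpace ℝ (Fin l))) (hΘ : IsOpen Θ)
    (G : EuclideanSpace ℝ (Fin l) → EuclideanSpace ℝ (Fin k) → N → EuclideanSpace ℝ (Fin d))
    (hG : ∀ θ ∈ Θ, Measurable fun w : EuclideanSpace ℝ (Fin k) × N => G θ w.1 w.2)
    (pg : EuclideanSpace ℝ (Fin l) → EuclideanSpace ℝ (Fin d) → EuclideanSpace ℝ (Fin k) → ℝ)
    (hGpg : ∀ θ ∈ Θ, IsCondDensity (G θ) νG (pg θ))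
    (hpg0 : ∀ θ ∈ Θ, ∀ x z, 0 < pg θ x z)
    (hpg : ContDiffOn ℝ 1
      (fun y : EuclideanSpace ℝ (Fin l) × EuclideanSpace ℝ (Fin d) × EuclideanSpace ℝ (Fin k) =>
        pg y.1 y.2.1 y.2.2) (Θ ×ˢ univ))
    -- the encoder and its conditional density `pe φ z x = p_e(z | x)`
    (Φ : Set (EuclideanSpace ℝ (Fin n))) (hΦ : IsOpen Φ)
    (E : EuclideanSpace ℝ (Fin n) → EuclideanSpace ℝ (Fin d) → M → EuclideanSpace ℝ (Fin k))
    (hE : ∀ φ ∈ Φ, Measurable fun w : EuclideanSpace ℝ (Fin d) × M => E φ w.1 w.2)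
    (pe : EuclideanSpace ℝ (Fin n) → EuclideanSpace ℝ (Fin k) → EuclideanSpace ℝ (Fin d) → ℝ)
    (hEpe : ∀ φ ∈ Φ, IsCondDensity (E φ) νE (pe φ))
    (hpe0 : ∀ φ ∈ Φ, ∀ z x, 0 < pe φ z x)
    (hpe : ContDiffOn ℝ 1
      (fun y : EuclideanSpace ℝ (Fin n) × EuclideanSpace ℝ (Fin k) × EuclideanSpace ℝ (Fin d) =>
        pe y.1 y.2.1 y.2.2) (Φ ×ˢ univ))
    -- the parameters at which the gradients are taken
    (θ : EuclideanSpace ℝ (Fin l)) (hθ : θ ∈ Θ) (φ : EuclideanSpace ℝ (Fin n)) (hφ : φ ∈ Φ)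
    -- the divergence is finite, and its integrand is dominated near `θ` and near `φ`
    (hL : Integrable (fDivIntegrand f (encJoint pr pe φ) (genJoint pz pg θ)))
    (hLθ : DominatedLipschitzAt volume
      (fun θ' => fDivIntegrand f (encJoint pr pe φ) (genJoint pz pg θ')) θ)
    (hLφ : DominatedLipschitzAt volume
      (fun φ' => fDivIntegrand f (encJoint pr pe φ') (genJoint pz pg θ)) φ)
    -- the transformations are differentiable in their parameters, with dominated increments
    (hGd : ∀ᵐ w ∂(densityMeasure pz).prod νG, DifferentiableAt ℝ (fun θ' => G θ' w.1 w.2) θ)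
    (hGl : DominatedLipschitzAt ((densityMeasure pz).prod νG) (fun θ' w => G θ' w.1 w.2) θ)
    (hEd : ∀ᵐ w ∂(densityMeasure pr).prod νE, DifferentiableAt ℝ (fun φ' => E φ' w.1 w.2) φ)
    (hEl : DominatedLipschitzAt ((densityMeasure pr).prod νE) (fun φ' w => E φ' w.1 w.2) φ)
    -- the fluxes are integrable, so that nothing escapes to infinity
    (hGflux : Integrable (fun w : EuclideanSpace ℝ (Fin k) × N =>
        deriv (fTilde f) (1 / ratio (encJoint pr pe φ) (genJoint pz pg θ) (G θ w.1 w.2, w.1)) *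
          ‖fderiv ℝ (fun θ' => G θ' w.1 w.2) θ‖)
      ((densityMeasure pz).prod νG))
    (hEflux : Integrable (fun w : EuclideanSpace ℝ (Fin d) × M =>
        deriv f (ratio (encJoint pr pe φ) (genJoint pz pg θ) (w.1, E φ w.1 w.2)) *
          ‖fderiv ℝ (fun φ' => E φ' w.1 w.2) φ‖)
      ((densityMeasure pr).prod νE))
    -- the two expectations in the conclusion exist
    (hGi : Integrable (genTerm f (encJoint pr pe φ) (genJoint pz pg θ) G θ)
      ((densityMeasure pz).prod νG))
    (hEi : Integrable (encTerm f (encJoint pr pe φ) (genJoint pz pg θ) E φ)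
      ((densityMeasure pr).prod νE)) :
    HasGradientAt (fun θ' => objective f pr pz pg pe θ' φ)
      (-∫ w, genTerm f (encJoint pr pe φ) (genJoint pz pg θ) G θ w ∂(densityMeasure pz).prod νG)
      θ ∧
    HasGradientAt (fun φ' => objective f pr pz pg pe θ φ')
      (∫ w, encTerm f (encJoint pr pe φ) (genJoint pz pg θ) E φ w ∂(densityMeasure pr).prod νE)
      φ := by

  have hq := contDiffOn_genJoint hpz hpg
  have hp := contDiffOn_encJoint hpr hpe
  have hq0 : ∀ θ' ∈ Θ, ∀ y, 0 < genJoint pz pg θ' y := fun θ' h y =>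
    mul_pos (hpz0 _) (hpg0 θ' h _ _)
  have hp0 : ∀ φ' ∈ Φ, ∀ y, 0 < encJoint pr pe φ' y := fun φ' h y =>
    mul_pos (hpr0 _) (hpe0 φ' h _ _)
  have hqθ := contDiff_section hq hθ
  have hpφ := contDiff_section hp hφ
  constructor
  · have hfun : ∀ θ', fDivIntegrand f (encJoint pr pe φ) (genJoint pz pg θ') = fun y =>
        encJoint pr pe φ y * fTilde f (genJoint pz pg θ' y / encJoint pr pe φ y) := fun θ' =>
      funext fun y => (mul_fTilde_div _ (hp0 φ hφ y).ne').symm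
    have hS' : ∀ w : EuclideanSpace ℝ (Fin k) × N,
        DifferentiableAt ℝ (fun θ' => G θ' w.1 w.2) θ →
        HasFDerivAt (fun θ' => (G θ' w.1 w.2, w.1))
          ((fderiv ℝ (fun θ' => G θ' w.1 w.2) θ).prod 0) θ := fun w hw =>
      hw.hasFDerivAt.prodMk (hasFDerivAt_const _ _)
    simp only [objective, fDiv, hfun] at hL hLθ ⊢
    rw [← integral_neg]
    refine hasGradientAt_divergence (S := fun θ' w => (G θ' w.1 w.2, w.1)) hΘ hθ hq hq0
      (fun θ' h => (hG θ' h).prodMk measurable_fst)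
      (fun θ' h => map_generator_eq_densityMeasure hpz.continuous.measurable
        (fun z => (hpz0 z).le) (hG θ' h) (measurable_section_of_contDiffOn hpg h) (hGpg θ' h))
      (hGd.mono fun w hw => (hS' w hw).differentiableAt)
      (hGl.congr_norm fun θ₁ θ₂ w => by simp) (contDiffOn_fTilde hf) hpφ (hp0 φ hφ) hL hLθ
      (hGflux.congr ?_) hGi.neg ?_
    · filter_upwards [hGd] with w hw
      -- In the sup norm the constant component adds nothing, so the pair's derivative has the norm
      -- of the Jacobian of `G`.
      rw [(hS' w hw).fderiv, ratio, one_div_div, ContinuousLinearMap.opNorm_prod]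
      simp
    · filter_upwards [hGd] with w hw v
      have hi : HasFDerivAt (fun x => (x, w.1)) (ContinuousLinearMap.inl ℝ _ _) (G θ w.1 w.2) :=
        hasFDerivAt_prodMk_left _ _
      have key := deriv_deriv_mul_fderiv_log (contDiffOn_fTilde hf)
        (ρ := fun y => genJoint pz pg θ y / encJoint pr pe φ y) hi
        ((hqθ.div hpφ fun y => (hp0 φ hφ y).ne').differentiable one_ne_zero _)
        (div_pos (hq0 θ hθ _) (hp0 φ hφ _)) (fderiv ℝ (fun θ' => G θ' w.1 w.2) θ v)
      -- The generator ratio is `1 / r`, so its logarithm is `-𝒟`; this matches the negated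
      -- integrand.
      have hlog : (fun x => logRatio (encJoint pr pe φ) (genJoint pz pg θ) (x, w.1)) =
          fun x => -Real.log (genJoint pz pg θ (x, w.1) / encJoint pr pe φ (x, w.1)) := by
        ext x
        rw [logRatio, ← Real.log_inv, inv_div]
      rw [(hS' w hw).fderiv]
      refine Eq.trans ?_ key
      simp only [genTerm, inner_neg_right, inner_smul_right,
        ContinuousLinearMap.adjoint_inner_right, scaleGen, ratio, one_div_div]
      rw [real_inner_comm, gradient, InnerProductSpace.toDual_symm_apply, hlog, fderiv_fun_neg,
        div_div_eq_mul_div, mul_div_assoc]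
      simp
  · have hS' : ∀ w : EuclideanSpace ℝ (Fin d) × M,
        DifferentiableAt ℝ (fun φ' => E φ' w.1 w.2) φ →
        HasFDerivAt (fun φ' => (w.1, E φ' w.1 w.2))
          (ContinuousLinearMap.prod 0 (fderiv ℝ (fun φ' => E φ' w.1 w.2) φ)) φ := fun w hw =>
      (hasFDerivAt_const _ _).prodMk hw.hasFDerivAt
    refine hasGradientAt_divergence (S := fun φ' w => (w.1, E φ' w.1 w.2)) hΦ hφ hp hp0
      (fun φ' h => measurable_fst.prodMk (hE φ' h))
      (fun φ' h => map_encoder_eq_densityMeasure hpr.continuous.measurable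
        (fun x => (hpr0 x).le) (hE φ' h) (measurable_section_of_contDiffOn hpe h) (hEpe φ' h))
      (hEd.mono fun w hw => (hS' w hw).differentiableAt)
      (hEl.congr_norm fun φ₁ φ₂ w => by simp) hf hqθ (hq0 θ hθ) hL hLφ
      (hEflux.congr ?_) hEi ?_
    · filter_upwards [hEd] with w hw
      rw [(hS' w hw).fderiv, ratio, ContinuousLinearMap.opNorm_prod]
      simp
    · filter_upwards [hEd] with w hw v
      have hi : HasFDerivAt (fun z => (w.1, z)) (ContinuousLinearMap.inr ℝ _ _) (E φ w.1 w.2) :=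
        hasFDerivAt_prodMk_right _ _
      have key := deriv_deriv_mul_fderiv_log hf
        (ρ := fun y => encJoint pr pe φ y / genJoint pz pg θ y) hi
        ((hpφ.div hqθ fun y => (hq0 θ hθ y).ne').differentiable one_ne_zero _)
        (div_pos (hp0 φ hφ _) (hq0 θ hθ _)) (fderiv ℝ (fun φ' => E φ' w.1 w.2) φ v)
      rw [(hS' w hw).fderiv]
      refine Eq.trans ?_ key
      simp only [encTerm, inner_smul_right, ContinuousLinearMap.adjoint_inner_right, scaleEnc,
        ratio]
      -- After the adjoint moves the Jacobian onto `v`, pairing with the gradient is applying the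
      -- derivative of `𝒟`.
      rw [real_inner_comm, gradient, InnerProductSpace.toDual_symm_apply]
      rfl
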